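/- Let $\mathbf{Cat}$ be the category of small categories. For a functor $F:\mathbb A\to\mathbb B$ let $\mathsf MF$ be the category whose objects are pairs $(A,\,x:B\cong FA)$ with $A\in\mathbb A$ and $x$ an isomorphism of $\mathbb B$, and whose arrows $(A,x)\to(A',x')$ are pairs $(b:B\to B',\,a:A\to A')$ with $x'b=F(a)\,x$. Let $\mathsf RF:\mathsf MF\to\mathbb B$, $(A,x:B\cong FA)\mapsto B$, and let $\mathsf R$ be the resulting monad on the arrow category $\mathbf{Cat}^{\mathbf 2}$, with unit $A\mapsto(A,\mathrm{id}_{FA})$ and multiplication $((A,x:B\cong FA),x':B'\cong B)\mapsto(A,xx')$. An $\mathsf R$-algebra is a functor $F:\mathbb A\to\mathbb B$ with a structure functor $S:\mathsf MF\to\mathbb A$ such that $FS=\mathsf RF$ and the unit and associativity laws hold; sending $(F,S)$ to $\mathbb B$ gives a fibration with finite products $\mathsf R\text{-}\mathbf{Alg}\to\mathbf{Cat}$. For a small category $\mathbb B$ let $\mathrm{Iso}(\mathbb B)$ be the category of isomorphisms of $\mathbb B$ and commutative squares. The functor $\langle\mathrm{cod},\mathrm{dom}\rangle:\mathrm{Iso}(\mathbb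 B)\to\mathbb B\times\mathbb B$ is an $\mathsf R$-algebra with the structure $s_{\mathbb B}$ that sends $(y:B_1\cong B_2,\ (b_2,b_1):(B_2',B_1')\cong(B_2,B_1))$ to $b_2^{-1}yb_1:B_1'\cong B_2'$. Let $\mathrm{refl}_{\mathbb B}:\mathbb B\to\mathrm{Iso}(\mathbb B)$ send $B$ to $\mathrm{id}_B$; it gives an algebra morphism (a loop) $\delta=(\langle1,1\rangle,\mathrm{refl}_{\mathbb B}):(\mathrm{Id}_{\mathbb B},\mathsf R\,\mathrm{Id}_{\mathbb B})\to(\langle\mathrm{cod},\mathrm{dom}\rangle,s_{\mathbb B})$ over the diagonal of $\mathbb B$, whose domain is terminal in the fibre over $\mathbb B$. Let $(F:\mathbb A\to\mathbb B,\,S)$ be an $\mathsf R$-algebra, and let $P=\mathrm{pr}_1^*(F,S)\wedge(\langle\mathrm{cod},\mathrm{dom}\rangle,s_{\mathbb B})$ be the product in the fibre over $\mathbb B\times\mathbb B$. A carrier for the loop $\delta$ at $(F,S)$ is an algebra morphism $t:P\to(F,S)$ over $\mathrm{pr}_2:\mathbb B\times\mathbb B\to\mathbb B$. It is strict if $t\circ\langle\sigma,\delta\,!\rangle=\mathrm{id}_{(F,S)}$,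 where $!$ is the unique vertical morphism from $(F,S)$ to $(\mathrm{Id}_{\mathbb B},\mathsf R\,\mathrm{Id}_{\mathbb B})$, and $\sigma:(F,S)\to\mathrm{pr}_1^*(F,S)$ is the morphism over the diagonal whose composite with the cartesian arrow $\mathrm{pr}_1^*(F,S)\to(F,S)$ is the identity. **Lemma.** There is exactly one strict carrier for the loop $\delta$ at $(F,S)$. When $P$ is realised on the functor $D:\mathsf MF\to\mathbb B\times\mathbb B$, $(A,x:B\cong FA)\mapsto(FA,B)$, with the structure $((A,x),(b_1,b_2):(B_1,B_2)\cong(FA,B))\mapsto(S(A,b_1),\,b_1^{-1}xb_2)$, this carrier is $(\mathrm{pr}_2,S)$. -/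

import Mathlib

open CategoryTheory MonoidalCategory CartesianMonoidalCategory

universe u v₁ u₁ v₂ u₂

/-! The algebraic weak factorisation system of isofibrations on the category `Cat` of small
categories, its fibration of algebras, and loops and carriers in a fibration. -/

namespace CatAWFS

/-! ### The category `M F` -/

section M
variable {A B : Type u} [Category.{u} A] [Category.{u} B]

/-- An object of `M F`: a pair `(A, x : B ≅ F A)`; here `pt = A`, `base = B`, `iso = x`.
For `F = 𝟭 B` this is the category of isomorphisms of `B` and commutative squares, the
isomorphism `x : B₁ ≅ B₂` having domain `base = B₁` and codomain `pt = B₂`. -/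
@[ext]
structure M (F : A ⥤ B) : Type u where
  pt : A
  base : B
  iso : base ≅ F.obj pt

variable {F : A ⥤ B}

/-- An arrow `(b, a)` of `M F`: `b : B ⟶ B'` and `a : A ⟶ A'` with `x ≫ F a = b ≫ x'`. -/
@[ext]
structure MHom (m n : M F) : Type u where
  base : m.base ⟶ n.base
  pt : m.pt ⟶ n.pt
  w : base ≫ n.iso.hom = m.iso.hom ≫ F.map pt

instance : Category.{u} (M F) where
  Hom m n := MHom m n
  id m := { base := 𝟙 _, pt := 𝟙 _, w := by simp }
  comp f g := { base := f.base ≫ g.base, pt := f.pt ≫ g.pt, w := by rw [Category.assoc, g.w, ← Category.assoc, f.w]; simp }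

@[ext]
theorem M.hom_ext {m n : M F} {f g : m ⟶ n} (h₁ : f.base = g.base) (h₂ : f.pt = g.pt) : f = g :=
  MHom.ext h₁ h₂

@[simp] theorem M.id_base (m : M F) : MHom.base (𝟙 m) = 𝟙 m.base := rfl
@[simp] theorem M.id_pt (m : M F) : MHom.pt (𝟙 m) = 𝟙 m.pt := rfl
@[simp] theorem M.comp_base {m n k : M F} (f : m ⟶ n) (g : n ⟶ k) :
    MHom.base (f ≫ g) = f.base ≫ g.base := rfl
@[simp] theorem M.comp_pt {m n k : M F} (f : m ⟶ n) (g : n ⟶ k) :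
    MHom.pt (f ≫ g) = f.pt ≫ g.pt := rfl

variable (F) in
/-- The functor `R F : M F ⥤ B`, `(A, x : B ≅ F A) ↦ B`; for `F = 𝟭 B` it is `dom`. -/
@[simps] abbrev M.toBase : M F ⥤ B where
  obj m := m.base
  map f := f.base

variable (F) in
/-- The projection `M F ⥤ A`, `(A, x : B ≅ F A) ↦ A`; for `F = 𝟭 B` it is `cod`. -/
@[simps] abbrev M.toPt : M F ⥤ A where
  obj m := m.pt
  map f := f.pt

theorem M.obj_ext {p q : M F} (e1 : p.pt = q.pt) (e2 : p.base = q.base)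
    (h : HEq p.iso.hom q.iso.hom) : p = q := by
  obtain ⟨a, b, x⟩ := p
  obtain ⟨a', b', y⟩ := q
  dsimp at e1 e2
  subst e1 e2
  congr 1
  ext
  exact eq_of_heq h

theorem M.functor_ext {C : Type u} [Category.{u} C] {P Q : C ⥤ M F}
    (h₁ : P ⋙ M.toPt F = Q ⋙ M.toPt F) (h₂ : P ⋙ M.toBase F = Q ⋙ M.toBase F)
    (h : ∀ c, HEq (P.obj c).iso.hom (Q.obj c).iso.hom) : P = Q := by
  have hobj : ∀ c, P.obj c = Q.obj c := fun c =>
    M.obj_ext (Functor.congr_obj h₁ c) (Functor.congr_obj h₂ c) (h c)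
  have key1 : ∀ {m n : M F} (h : m = n), MHom.base (eqToHom h) = eqToHom (congrArg M.base h) := by
    rintro m _ rfl; rfl
  have key2 : ∀ {m n : M F} (h : m = n), MHom.pt (eqToHom h) = eqToHom (congrArg M.pt h) := by
    rintro m _ rfl; rfl
  refine CategoryTheory.Functor.ext hobj ?_
  intro X Y f
  apply M.hom_ext
  · rw [M.comp_base, M.comp_base, key1, key1]
    exact Functor.congr_hom h₂ f
  · rw [M.comp_pt, M.comp_pt, key2, key2]
    exact Functor.congr_hom h₁ f

/-- The functor `M F ⥤ M (𝟭 B)`, `(A, x) ↦ x`, from `M F` to the category of isomorphisms of `B`.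
Together with `M.toPt F` it exhibits `M F` as the pullback of `F` and `cod`. -/
@[simps] def M.toIso (F : A ⥤ B) : M F ⥤ M (𝟭 B) where
  obj m := ⟨F.obj m.pt, m.base, m.iso⟩
  map f := { base := f.base, pt := F.map f.pt, w := f.w }

/-- The functor into the pullback `M F` of `F` and `cod` induced by a commutative square. -/
def M.pullLift {C : Type u} [Category.{u} C] (P : C ⥤ A) (Q : C ⥤ M (𝟭 B))
    (h : P ⋙ F = Q ⋙ M.toPt (𝟭 B)) : C ⥤ M F where
  obj c := ⟨P.obj c, (Q.obj c).base, (Q.obj c).iso ≪≫ eqToIso (Functor.congr_obj h c).symm⟩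
  map {c d} g :=
    { base := (Q.map g).base
      pt := P.map g
      w := by
        have h1 : F.map (P.map g) = _ ≫ (Q.map g).pt ≫ _ := Functor.congr_hom h g
        have h2 : (Q.map g).base ≫ (Q.obj d).iso.hom = (Q.obj c).iso.hom ≫ (Q.map g).pt :=
          (Q.map g).w
        change (Q.map g).base ≫ (Q.obj d).iso.hom ≫ eqToHom (Functor.congr_obj h d).symm =
          ((Q.obj c).iso.hom ≫ eqToHom (Functor.congr_obj h c).symm) ≫ F.map (P.map g)
        rw [h1, ← Category.assoc, h2]
        simp }

theorem M.pullLift_toIso {C : Type u} [Category.{u} C] (P : C ⥤ A) (Q : C ⥤ M (𝟭 B))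
    (h : P ⋙ F = Q ⋙ M.toPt (𝟭 B)) : M.pullLift P Q h ⋙ M.toIso F = Q :=
  M.functor_ext h rfl fun c => comp_eqToHom_heq _ (Functor.congr_obj h c).symm

theorem M.pull_ext {C : Type u} [Category.{u} C] {P Q : C ⥤ M F}
    (h₁ : P ⋙ M.toPt F = Q ⋙ M.toPt F) (h₂ : P ⋙ M.toIso F = Q ⋙ M.toIso F) : P = Q :=
  M.functor_ext h₁ (congrArg (fun T => T ⋙ M.toBase (𝟭 B)) h₂) fun c =>
    congr_arg_heq (fun m : M (𝟭 B) => m.iso.hom) (Functor.congr_obj h₂ c)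

variable {A' B' : Type u} [Category.{u} A'] [Category.{u} B'] {F' : A' ⥤ B'}

/-- Functoriality of `M` on commutative squares of functors. -/
@[simps] def M.map (H : A ⥤ A') (K : B ⥤ B') (h : H ⋙ F' = F ⋙ K) : M F ⥤ M F' where
  obj m := ⟨H.obj m.pt, K.obj m.base,
    K.mapIso m.iso ≪≫ eqToIso (Functor.congr_obj h m.pt).symm⟩
  map {m n} g :=
    { base := K.map g.base
      pt := H.map g.pt
      w := by
        have h1 : F'.map (H.map g.pt) = _ := Functor.congr_hom h g.pt
        have h2 := congrArg K.map g.w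
        rw [Functor.map_comp, Functor.map_comp] at h2
        dsimp
        rw [reassoc_of% h2, h1]
        simp }

/-- The functor `L F : A ⥤ M F`, `A ↦ (A, 𝟙 (F A))`, which is the unit of the monad `R` at `F`;
for `F = 𝟭 B` it is `refl`, sending an object to its identity. -/
@[simps] def M.unit (F : A ⥤ B) : A ⥤ M F where
  obj a := ⟨a, F.obj a, Iso.refl _⟩
  map f := { base := F.map f, pt := f, w := by simp }

/-- The multiplication of `R` at `F`: `((A, x : B ≅ F A), x' : B' ≅ B) ↦ (A, x' ≫ x)`. -/
@[simps] def M.mult (F : A ⥤ B) : M (M.toBase F) ⥤ M F where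
  obj m := ⟨m.pt.pt, m.base, m.iso ≪≫ m.pt.iso⟩
  map {m n} f :=
    { base := f.base
      pt := f.pt.pt
      w := by
        have h : f.base ≫ n.iso.hom = m.iso.hom ≫ f.pt.base := f.w
        have h' := f.pt.w
        dsimp
        rw [reassoc_of% h, h']
        simp }

theorem M.map_iso_heq (H : A ⥤ A') (K : B ⥤ B') (h : H ⋙ F' = F ⋙ K) (m : M F) :
    HEq ((M.map H K h).obj m).iso.hom (K.map m.iso.hom) :=
  comp_eqToHom_heq _ (Functor.congr_obj h m.pt).symm

theorem heq_map (K : B ⥤ B') {b c b' c' : B} {f : b ⟶ c} {g : b' ⟶ c'} (h₁ : b = b')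
    (h₂ : c = c') (h : HEq f g) : HEq (K.map f) (K.map g) := by
  subst h₁ h₂; cases h; rfl

theorem heq_comp {b c d b' c' d' : B} {f : b ⟶ c} {g : c ⟶ d} {f' : b' ⟶ c'} {g' : c' ⟶ d'}
    (h₁ : b = b') (h₂ : c = c') (h₃ : d = d') (h : HEq f f') (h' : HEq g g') :
    HEq (f ≫ g) (f' ≫ g') := by
  subst h₁ h₂ h₃; cases h; cases h'; rfl

theorem M.map_id (F : A ⥤ B) : M.map (F := F) (F' := F) (𝟭 A) (𝟭 B) rfl = 𝟭 (M F) :=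
  M.functor_ext rfl rfl fun c => M.map_iso_heq _ _ _ c

theorem M.map_comp {A'' B'' : Type u} [Category.{u} A''] [Category.{u} B''] {F'' : A'' ⥤ B''}
    (H : A ⥤ A') (K : B ⥤ B') (h : H ⋙ F' = F ⋙ K)
    (H' : A' ⥤ A'') (K' : B' ⥤ B'') (h' : H' ⋙ F'' = F' ⋙ K')
    (h'' : (H ⋙ H') ⋙ F'' = F ⋙ K ⋙ K') :
    M.map (H ⋙ H') (K ⋙ K') h'' = M.map H K h ⋙ M.map H' K' h' :=
  M.functor_ext rfl rfl fun c => (M.map_iso_heq _ _ _ c).trans <| HEq.symm <|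
    (M.map_iso_heq H' K' h' _).trans <|
      heq_map K' rfl (Functor.congr_obj h c.pt) (M.map_iso_heq _ _ _ c)

theorem M.unit_naturality (H : A ⥤ A') (K : B ⥤ B') (h : H ⋙ F' = F ⋙ K) :
    H ⋙ M.unit F' = M.unit F ⋙ M.map H K h :=
  M.functor_ext rfl h fun c => HEq.symm <| (M.map_iso_heq H K h _).trans <| by
    change HEq (K.map (𝟙 (F.obj c))) (𝟙 (F'.obj (H.obj c)))
    rw [K.map_id, show F'.obj (H.obj c) = K.obj (F.obj c) from Functor.congr_obj h c]

theorem M.mult_naturality (H : A ⥤ A') (K : B ⥤ B') (h : H ⋙ F' = F ⋙ K) :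
    M.map (F := M.toBase F) (F' := M.toBase F') (M.map H K h) K rfl ⋙ M.mult F' =
      M.mult F ⋙ M.map H K h :=
  M.functor_ext rfl rfl fun c => HEq.symm <| (M.map_iso_heq H K h _).trans <| by
    change HEq (K.map (c.iso.hom ≫ c.pt.iso.hom)) _
    rw [K.map_comp]
    exact heq_comp rfl rfl (Functor.congr_obj h c.pt.pt).symm
      (M.map_iso_heq (F := M.toBase F) (F' := M.toBase F') _ _ rfl c).symm
      (M.map_iso_heq H K h c.pt).symm

theorem M.mult_assoc (F : A ⥤ B) :
    M.map (F := M.toBase (M.toBase F)) (F' := M.toBase F) (M.mult F) (𝟭 B) rfl ⋙ M.mult F =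
      M.mult (M.toBase F) ⋙ M.mult F :=
  M.functor_ext rfl rfl fun c => heq_of_eq <| by
    change (c.iso.hom ≫ 𝟙 _) ≫ c.pt.iso.hom ≫ c.pt.pt.iso.hom =
      (c.iso.hom ≫ c.pt.iso.hom) ≫ c.pt.pt.iso.hom
    rw [Category.comp_id, Category.assoc]

theorem M.unit_mult (F : A ⥤ B) : M.unit (M.toBase F) ⋙ M.mult F = 𝟭 _ :=
  M.functor_ext rfl rfl fun c => heq_of_eq (Category.id_comp c.iso.hom)

theorem M.map_unit_mult (F : A ⥤ B) :
    M.map (F := F) (F' := M.toBase F) (M.unit F) (𝟭 B) rfl ⋙ M.mult F = 𝟭 _ :=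
  M.functor_ext rfl rfl fun c => heq_of_eq <|
    (Category.comp_id _).trans (Category.comp_id c.iso.hom)

end M

/-! ### The monad `R` on the arrow category of `Cat`, and its algebras -/

theorem sq {F G : Arrow Cat.{u, u}} (f : F ⟶ G) :
   f.left.toFunctor ⋙ G.hom.toFunctor = F.hom.toFunctor ⋙ f.right.toFunctor :=
  congrArg Cat.Hom.toFunctor f.w

theorem arrow_ext {F G : Arrow Cat.{u, u}} {f g : F ⟶ G}
   (h₁ : f.left.toFunctor = g.left.toFunctor) (h₂ : f.right.toFunctor = g.right.toFunctor) : f = g :=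
  Arrow.hom_ext f g (Cat.ext h₁) (Cat.ext h₂)

/-- `R F : M F ⥤ B` as an object of the arrow category. -/
def Robj (F : Arrow Cat.{u, u}) : Arrow Cat.{u, u} :=
  Arrow.mk (M.toBase F.hom.toFunctor).toCatHom

/-- The endofunctor `R` of the arrow category of `Cat`. -/
def R : Arrow Cat.{u, u} ⥤ Arrow Cat.{u, u} where
  obj F := Robj F
  map {F G} f := Arrow.homMk (f := Robj F) (g := Robj G)
    (u := (M.map f.left.toFunctor f.right.toFunctor (sq f)).toCatHom) (v := f.right) rfl
  map_id F := arrow_ext (M.map_id F.hom.toFunctor) rfl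
  map_comp f g := arrow_ext (M.map_comp _ _ (sq f) _ _ (sq g) (sq (f ≫ g))) rfl

/-- The monad `R`, with unit `L` and multiplication `M.mult`. -/
def RMonad : Monad (Arrow Cat.{u, u}) where
  toFunctor := R
  η :=
    { app F := Arrow.homMk (f := F) (g := Robj F)
        (u := (M.unit F.hom.toFunctor).toCatHom) (v := 𝟙 F.right) rfl
      naturality _ _ f := arrow_ext (M.unit_naturality _ _ (sq f)) rfl }
  μ :=
    { app F := Arrow.homMk (f := Robj (Robj F)) (g := Robj F)
        (u := (M.mult F.hom.toFunctor).toCatHom) (v := 𝟙 F.right) rfl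
      naturality _ _ f := arrow_ext (M.mult_naturality _ _ (sq f)) rfl }
  assoc F := arrow_ext (M.mult_assoc F.hom.toFunctor) rfl
  left_unit F := arrow_ext (M.unit_mult F.hom.toFunctor) rfl
  right_unit F := arrow_ext (M.map_unit_mult F.hom.toFunctor) rfl

/-- The category `R-Alg` of algebras for the monad `R`. -/
abbrev RAlg := RMonad.{u}.Algebra

/-- The functor `R-Alg ⥤ Cat` sending an algebra `(F : A ⥤ B, S)` to `B`. -/
def algFib : RAlg.{u} ⥤ Cat.{u, u} := RMonad.{u}.forget ⋙ Arrow.rightFunc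


section Alg

/-- The structure functor `S : M F ⥤ A` of an algebra on `F : A ⥤ B`. -/
def RAlg.str (X : RAlg.{u}) : M X.A.hom.toFunctor ⥤ X.A.left := X.a.left.toFunctor

theorem RAlg.a_right (X : RAlg.{u}) : X.a.right = 𝟙 X.A.right :=
  (Category.id_comp _).symm.trans (congrArg (fun f => f.right) X.unit)

theorem RAlg.str_comp (X : RAlg.{u}) : X.str ⋙ X.A.hom.toFunctor = M.toBase X.A.hom.toFunctor := by
  have h := sq X.a
  rw [RAlg.a_right] at h
  exact h

theorem RAlg.unit_str (X : RAlg.{u}) : M.unit X.A.hom.toFunctor ⋙ X.str = 𝟭 _ :=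
  congrArg (fun f => f.left.toFunctor) X.unit

theorem M.map_congr {A B : Type u} [Category.{u} A] [Category.{u} B] {F : A ⥤ B}
    {A' B' : Type u} [Category.{u} A'] [Category.{u} B'] {F' : A' ⥤ B'}
    {H H' : A ⥤ A'} {K K' : B ⥤ B'} (h : H ⋙ F' = F ⋙ K) (h₁ : H = H') (h₂ : K = K') :
    M.map H K h = M.map H' K' (h₁ ▸ h₂ ▸ h) := by
  subst h₁ h₂; rfl

theorem RAlg.mult_str (X : RAlg.{u}) : M.mult X.A.hom.toFunctor ⋙ X.str =
    M.map (F := M.toBase X.A.hom.toFunctor) X.str (𝟭 _) X.str_comp ⋙ X.str := by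
  have h : M.mult X.A.hom.toFunctor ⋙ X.str =
    M.map (F := M.toBase X.A.hom.toFunctor) X.str X.a.right.toFunctor (sq X.a) ⋙ X.str :=
    congrArg (fun f => f.left.toFunctor) X.assoc
  exact h.trans (congrArg (fun T => T ⋙ X.str) (M.map_congr (F := M.toBase X.A.hom.toFunctor)
    (F' := X.A.hom.toFunctor) (sq X.a) rfl (congrArg Cat.Hom.toFunctor X.a_right)))

/-- An algebra `(F, S)` from functors `F : A ⥤ B` and `S : M F ⥤ A` satisfying the algebra laws. -/
def mkAlg {A B : Type u} [Category.{u} A] [Category.{u} B] (F : A ⥤ B) (S : M F ⥤ A)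
    (h : S ⋙ F = M.toBase F) (hu : M.unit F ⋙ S = 𝟭 A)
    (hm : M.mult F ⋙ S = M.map (F := M.toBase F) (F' := F) S (𝟭 B) h ⋙ S) : RAlg.{u} where
  A := Arrow.mk F.toCatHom
  a := Arrow.homMk (f := Robj (Arrow.mk F.toCatHom)) (g := Arrow.mk F.toCatHom)
    (u := S.toCatHom) (v := 𝟙 _) (Cat.ext h)
  unit := arrow_ext hu rfl
  assoc := arrow_ext hm rfl

/-- An algebra morphism `(K, H)` from a commutative square compatible with the structures. -/
def mkHom {X Y : RAlg.{u}} (H : X.A.left ⥤ Y.A.left) (K : X.A.right ⥤ Y.A.right)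
    (h : H ⋙ Y.A.hom.toFunctor = X.A.hom.toFunctor ⋙ K)
    (hs : M.map H K h ⋙ Y.str = X.str ⋙ H) : X ⟶ Y where
  f := Arrow.homMk (u := ⟨H⟩) (v := ⟨K⟩) (Cat.ext h)
  h := arrow_ext hs (by
    change K ⋙ Y.a.right.toFunctor = X.a.right.toFunctor ⋙ K
    rw [RAlg.a_right, RAlg.a_right]
    rfl)

theorem RAlg.hom_str {X Y : RAlg.{u}} (f : X ⟶ Y) :
    M.map f.f.left.toFunctor f.f.right.toFunctor (sq f.f) ⋙ Y.str = X.str ⋙ f.f.left.toFunctor :=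
  congrArg (fun f => f.left.toFunctor) f.h

theorem RAlg.hom_ext {X Y : RAlg.{u}} {f g : X ⟶ Y} (h₁ : f.f.left.toFunctor = g.f.left.toFunctor)
    (h₂ : f.f.right.toFunctor = g.f.right.toFunctor) : f = g :=
  Monad.Algebra.Hom.ext (arrow_ext h₁ h₂)

theorem prod_functor_ext {C A B : Type u} [Category.{u} C] [Category.{u} A] [Category.{u} B]
    {P Q : C ⥤ A × B} (h₁ : P ⋙ CategoryTheory.Prod.fst A B = Q ⋙ CategoryTheory.Prod.fst A B)
    (h₂ : P ⋙ CategoryTheory.Prod.snd A B = Q ⋙ CategoryTheory.Prod.snd A B) : P = Q := by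
  have e : ∀ P : C ⥤ A × B, P = (P ⋙ CategoryTheory.Prod.fst A B).prod' (P ⋙ CategoryTheory.Prod.snd A B) := fun _ => rfl
  rw [e P, e Q, h₁, h₂]

variable (B : Type u) [Category.{u} B]

/-- The category of isomorphisms of `B`. -/
abbrev IsoCat := M (𝟭 B)

/-- The functor `⟨cod, dom⟩ : IsoCat B ⥤ B × B`. -/
def endpoints : IsoCat B ⥤ B × B := (M.toPt (𝟭 B)).prod' (M.toBase (𝟭 B))

theorem conj_assoc {B : Type u} [Category.{u} B] {a b c d e f : B} (g₁ : a ⟶ b) (g₂ : b ⟶ c)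
    (x : c ⟶ d) (g₃ : d ⟶ e) (g₄ : e ⟶ f) :
    (g₁ ≫ g₂) ≫ x ≫ g₃ ≫ g₄ = (g₁ ≫ 𝟙 b) ≫ (g₂ ≫ x ≫ g₃) ≫ 𝟙 e ≫ g₄ := by
  simp

theorem conj_sq {B : Type u} [Category.{u} B] {p₁ p₂ q₁ q₂ a₁ a₂ c₁ c₂ : B}
    {f₁ : p₁ ⟶ q₁} {f₂ : p₂ ⟶ q₂} {i₁ : p₁ ≅ a₁} {i₂ : p₂ ≅ a₂} {j₁ : q₁ ≅ c₁} {j₂ : q₂ ≅ c₂}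
    {g₁ : a₁ ⟶ c₁} {g₂ : a₂ ⟶ c₂} {x : a₂ ⟶ a₁} {y : c₂ ⟶ c₁}
    (h₁ : f₁ ≫ j₁.hom = i₁.hom ≫ g₁) (h₂ : f₂ ≫ j₂.hom = i₂.hom ≫ g₂) (h : g₂ ≫ y = x ≫ g₁) :
    f₂ ≫ j₂.hom ≫ y ≫ j₁.inv = (i₂.hom ≫ x ≫ i₁.inv) ≫ f₁ := by
  have h₃ : i₁.inv ≫ f₁ = g₁ ≫ j₁.inv := by
    rw [Iso.inv_comp_eq, ← reassoc_of% h₁]; simp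
  rw [reassoc_of% h₂, reassoc_of% h]
  simp [h₃]

/-- The structure of the path object: `(y : B₁ ≅ B₂, (b₂, b₁) : (B₂', B₁') ≅ (B₂, B₁))` is sent
to the composite `b₁ ≫ y ≫ b₂⁻¹ : B₁' ≅ B₂'`. -/
def pathStr : M (endpoints B) ⥤ IsoCat B where
  obj m :=
    { pt := m.base.1
      base := m.base.2
      iso := (CategoryTheory.Prod.snd B B).mapIso m.iso ≪≫ m.pt.iso ≪≫ ((CategoryTheory.Prod.fst B B).mapIso m.iso).symm }
  map {m n} f :=
    { base := f.base.2
      pt := f.base.1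
      w := conj_sq (i₁ := (CategoryTheory.Prod.fst B B).mapIso m.iso)
        (i₂ := (CategoryTheory.Prod.snd B B).mapIso m.iso)
        (j₁ := (CategoryTheory.Prod.fst B B).mapIso n.iso)
        (j₂ := (CategoryTheory.Prod.snd B B).mapIso n.iso)
        (congrArg Prod.fst f.w) (congrArg Prod.snd f.w) f.pt.w }

/-- The algebra `(⟨cod, dom⟩, s_B)` over `B × B`. -/
def pathAlg : RAlg.{u} := mkAlg (endpoints B) (pathStr B) rfl
  (M.functor_ext rfl rfl fun c => heq_of_eq <| by
    change 𝟙 _ ≫ c.iso.hom ≫ 𝟙 _ = c.iso.hom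
    simp)
  (M.functor_ext rfl rfl fun c => heq_of_eq <| by
    change (c.iso.hom.2 ≫ c.pt.iso.hom.2) ≫ c.pt.pt.iso.hom ≫ (c.pt.iso.inv.1 ≫ c.iso.inv.1) =
     (c.iso.hom.2 ≫ 𝟙 _) ≫ (c.pt.iso.hom.2 ≫ c.pt.pt.iso.hom ≫ c.pt.iso.inv.1) ≫ 𝟙 _ ≫ c.iso.inv.1
    exact conj_assoc _ _ _ _ _)

/-- The algebra `(𝟭 B, R (𝟭 B))`. -/
def unitAlg : RAlg.{u} := mkAlg (𝟭 B) (M.toBase (𝟭 B)) rfl rfl rfl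

/-- The algebra morphism `(⟨1, 1⟩, refl) : (𝟭 B, R (𝟭 B)) ⟶ (⟨cod, dom⟩, s_B)`. -/
def reflHom : unitAlg B ⟶ pathAlg B :=
  mkHom (M.unit (𝟭 B)) ((𝟭 B).prod' (𝟭 B)) rfl
   (M.functor_ext rfl rfl fun (c : M (𝟭 B)) => heq_of_eq <| by
     change (c.iso.hom ≫ 𝟙 _) ≫ 𝟙 _ ≫ (𝟙 _ ≫ c.iso.inv) = 𝟙 c.base
     simp)


variable (X : RAlg.{u})

/-- The underlying functor `F : A ⥤ B` of an algebra. -/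
abbrev RAlg.fn : X.A.left ⥤ X.A.right := X.A.hom.toFunctor

/-- The functor `F × 1 : A × B ⥤ B × B`. -/
def reindexFn : (X.A.left × X.A.right) ⥤ (X.A.right × X.A.right) :=
  X.fn.prod (𝟭 _)

/-- The structure on `F × 1` induced by that on `F`:
`((A, B), (b₁, b₂) : (B₁, B₂) ≅ (F A, B)) ↦ (S (A, b₁), B₂)`. -/
def reindexStr : M (reindexFn X) ⥤ X.A.left × X.A.right :=
  (M.map (F := reindexFn X) (F' := X.fn) (CategoryTheory.Prod.fst _ _)
    (CategoryTheory.Prod.fst _ _) rfl ⋙ X.str).prod'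
    (M.toBase (reindexFn X) ⋙ CategoryTheory.Prod.snd _ _)

theorem str_mult_aux {A' B' : Type u} [Category.{u} A'] [Category.{u} B'] (G : A' ⥤ B')
    (S : M G ⥤ A') (h : S ⋙ G = M.toBase G) (H : A' ⥤ X.A.left) (K : B' ⥤ X.A.right)
    (hHK : H ⋙ X.fn = G ⋙ K) (hS : S ⋙ H = M.map H K hHK ⋙ X.str) :
    M.mult G ⋙ M.map H K hHK ⋙ X.str =
      M.map (F := M.toBase G) S (𝟭 B') h ⋙ M.map H K hHK ⋙ X.str := by
  have e1 := M.mult_naturality H K hHK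
  have e2 := X.mult_str
  rw [← Functor.assoc, ← e1, Functor.assoc, e2, ← Functor.assoc, ← Functor.assoc]
  congr 1
  rw [← M.map_comp (F := M.toBase G) (F' := G) (F'' := X.fn) S (𝟭 _) h H K hHK
     (by rw [Functor.assoc, hHK, ← Functor.assoc, h]; rfl)]
  rw [← M.map_comp (F := M.toBase G) (F' := M.toBase X.fn) (F'' := X.fn) (M.map H K hHK) K rfl X.str (𝟭 _)
     X.str_comp (by rw [Functor.assoc, X.str_comp]; rfl)]
  exact M.map_congr _ hS.symm rfl

theorem str_unit_aux {A' B' : Type u} [Category.{u} A'] [Category.{u} B'] {G : A' ⥤ B'}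
    (H : A' ⥤ X.A.left) (K : B' ⥤ X.A.right) (hHK : H ⋙ X.fn = G ⋙ K) :
    M.unit G ⋙ M.map H K hHK ⋙ X.str = H := by
  rw [← Functor.assoc, ← M.unit_naturality, Functor.assoc, X.unit_str]
  rfl

/-- The reindexing of the algebra `(F, S)` along the first projection `B × B ⥤ B`. -/
def reindexAlg : RAlg.{u} := mkAlg (reindexFn X) (reindexStr X)
  (prod_functor_ext
    (congrArg (fun T => M.map (F := reindexFn X) (F' := X.fn) (CategoryTheory.Prod.fst _ _)
      (CategoryTheory.Prod.fst _ _) rfl ⋙ T) X.str_comp) rfl)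
  (prod_functor_ext (str_unit_aux X (G := reindexFn X) (CategoryTheory.Prod.fst _ _)
    (CategoryTheory.Prod.fst _ _) rfl) rfl)
  (prod_functor_ext (str_mult_aux X (reindexFn X) (reindexStr X) _ (CategoryTheory.Prod.fst _ _)
    (CategoryTheory.Prod.fst _ _) rfl rfl) rfl)


/-- The functor `D : M F ⥤ B × B`, `(A, x : B ≅ F A) ↦ (F A, B)`. -/
def domainFn : M X.fn ⥤ (X.A.right × X.A.right) := (M.toPt X.fn ⋙ X.fn).prod' (M.toBase X.fn)

theorem domainStr_aux :
    (M.map (F := domainFn X) (M.toPt X.fn) (CategoryTheory.Prod.fst _ _) rfl ⋙ X.str) ⋙ X.fn =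
    (M.map (F := domainFn X) (F' := endpoints X.A.right) (M.toIso X.fn) (𝟭 _) rfl ⋙
      pathStr X.A.right) ⋙ M.toPt (𝟭 X.A.right) :=
  congrArg (fun T => M.map (F := domainFn X) (M.toPt X.fn) (CategoryTheory.Prod.fst _ _) rfl ⋙ T)
    X.str_comp

/-- The structure `S_D : M D ⥤ M F` induced by `S` and `s_B`:
`((A, x : B ≅ F A), (b₁, b₂) : (B₁, B₂) ≅ (F A, B)) ↦ (S (A, b₁), b₂ ≫ x ≫ b₁⁻¹)`. -/
def domainStr : M (domainFn X) ⥤ M X.fn :=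
  M.pullLift (M.map (F := domainFn X) (M.toPt X.fn) (CategoryTheory.Prod.fst _ _) rfl ⋙ X.str)
    (M.map (F := domainFn X) (F' := endpoints X.A.right) (M.toIso X.fn) (𝟭 _) rfl ⋙
      pathStr X.A.right) (domainStr_aux X)

theorem domainStr_toIso : domainStr X ⋙ M.toIso X.fn =
    M.map (F := domainFn X) (F' := endpoints X.A.right) (M.toIso X.fn) (𝟭 _) rfl ⋙
      pathStr X.A.right := M.pullLift_toIso _ _ (domainStr_aux X)

/-- The algebra `(D, S_D)`, the product over `B × B` of the reindexing of `(F, S)` along the first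
projection and the path object. -/
def domainAlg : RAlg.{u} := mkAlg (domainFn X) (domainStr X)
  (congrArg (fun T => T ⋙ endpoints X.A.right) (domainStr_toIso X))
  (M.pull_ext (str_unit_aux X (G := domainFn X) (M.toPt X.fn) (CategoryTheory.Prod.fst _ _) rfl) <|
    (congrArg (fun T => M.unit (domainFn X) ⋙ T) (domainStr_toIso X)).trans
    (str_unit_aux (pathAlg X.A.right) (G := domainFn X) (M.toIso X.fn) (𝟭 _) rfl))
  (M.pull_ext (str_mult_aux X (domainFn X) (domainStr X) _ (M.toPt X.fn)
    (CategoryTheory.Prod.fst _ _) rfl rfl) <|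
    (congrArg (fun T => M.mult (domainFn X) ⋙ T) (domainStr_toIso X)).trans <|
    (str_mult_aux (pathAlg X.A.right) (domainFn X) (domainStr X)
       (congrArg (fun T => T ⋙ endpoints X.A.right) (domainStr_toIso X)) (M.toIso X.fn) (𝟭 _) rfl
       (domainStr_toIso X)).trans <|
    (congrArg (fun T => M.map (F := M.toBase (domainFn X)) (F' := domainFn X) (domainStr X) (𝟭 _)
       (congrArg (fun T => T ⋙ endpoints X.A.right) (domainStr_toIso X)) ⋙ T)
       (domainStr_toIso X).symm))

end Alg

/-! ### Loops and carriers in a fibration with finite products `p : E ⥤ B` -/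

section General

open Limits

variable {E : Type u₁} [Category.{v₁} E] {B : Type u₂} [Category.{v₂} B]
  [CartesianMonoidalCategory B] {p : E ⥤ B}

variable (p) in
/-- A loop on `X`: an object `obj` over `X × X` and an arrow over the diagonal into it from the
terminal object `top` of the fibre over `X`. -/
structure Loop (X : B) where
  top : p.Fiber X
  isTerminal : IsTerminal top
  obj : p.Fiber (X ⊗ X)
  hom : top.1 ⟶ obj.1
  isHomLift : p.IsHomLift (lift (𝟙 X) (𝟙 X)) hom

/-- The product `pr₁^* A ∧ I` in the fibre over `X × X`, where `I` is the object of the loop: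
`reindex = pr₁^* A` is given by a cartesian arrow into `A` over the first projection, and `obj` is
a product of `reindex` and `I` in the fibre which is stable under reindexing, that is to say
`⟨φ₁, φ₂⟩` exists uniquely over `f` for all `φ₁` and `φ₂` over the same arrow `f`. -/
structure TransportDomain {X : B} (ℓ : Loop p X) (A : p.Fiber X) where
  reindex : p.Fiber (X ⊗ X)
  proj : reindex.1 ⟶ A.1
  cartesian : p.IsStronglyCartesian (fst X X) proj
  obj : p.Fiber (X ⊗ X)
  π₁ : obj ⟶ reindex
  π₂ : obj ⟶ ℓ.obj
  existsUnique_lift : ∀ {C : E} (f : p.obj C ⟶ X ⊗ X) (φ₁ : C ⟶ reindex.1) (φ₂ : C ⟶ ℓ.obj.1),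
    p.IsHomLift f φ₁ → p.IsHomLift f φ₂ →
      ∃! ψ : C ⟶ obj.1, p.IsHomLift f ψ ∧ ψ ≫ π₁.1 = φ₁ ∧ ψ ≫ π₂.1 = φ₂

variable {X : B} {ℓ : Loop p X} {A : p.Fiber X}

theorem TransportDomain.existsUnique_refl (D : TransportDomain ℓ A) :
    ∃! c : A.1 ⟶ D.obj.1, p.IsHomLift (lift (𝟙 X) (𝟙 X)) c ∧
      c ≫ D.π₁.1 ≫ D.proj = 𝟙 A.1 ∧ c ≫ D.π₂.1 = (ℓ.isTerminal.from A).1 ≫ ℓ.hom := by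
  obtain ⟨A, rfl⟩ := A
  have := D.cartesian
  have h1 : p.IsHomLift (lift (𝟙 (p.obj A)) (𝟙 _))
      ((ℓ.isTerminal.from ⟨A, rfl⟩).1 ≫ ℓ.hom) := by
    have := (ℓ.isTerminal.from ⟨A, rfl⟩).2
    have := ℓ.isHomLift
    infer_instance
  obtain ⟨k, ⟨hk1, hk2⟩, hk3⟩ := Functor.IsStronglyCartesian.universal_property p
    (fst (p.obj A) (p.obj A)) D.proj (lift (𝟙 _) (𝟙 _)) (𝟙 _) (by simp) (𝟙 A)
  obtain ⟨c, ⟨hc1, hc2, hc3⟩, hc4⟩ := D.existsUnique_lift _ k _ hk1 h1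
  refine ⟨c, ⟨hc1, by rw [← Category.assoc, hc2, hk2], hc3⟩, ?_⟩
  rintro c' ⟨h1, h2, h3⟩
  refine hc4 c' ⟨h1, hk3 _ ⟨?_, by rw [Category.assoc, h2]⟩, h3⟩
  have := D.π₁.2
  infer_instance

/-- The arrow `⟨σ, δ ∘ !⟩ : A ⟶ pr₁^* A ∧ I` over the diagonal, where `σ : A ⟶ pr₁^* A` is the arrow
over the diagonal with `σ ≫ proj = 𝟙 A`, and `δ` is the arrow of the loop. -/
noncomputable def TransportDomain.refl (D : TransportDomain ℓ A) : A.1 ⟶ D.obj.1 :=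
  D.existsUnique_refl.choose

/-- A carrier for the loop at `A`: an arrow `pr₁^* A ∧ I ⟶ A` over the second projection. -/
structure Carrier (D : TransportDomain ℓ A) where
  hom : D.obj.1 ⟶ A.1
  isHomLift : p.IsHomLift (snd X X) hom

/-- A carrier is strict if its composite with `A ⟶ pr₁^* A ∧ I` is the identity of `A`. -/
def Carrier.IsStrict {D : TransportDomain ℓ A} (t : Carrier D) : Prop :=
  D.refl ≫ t.hom = 𝟙 A.1

end General


/-! ### The loop on `B` and the domain of carriers at an algebra, in the fibration `algFib` -/

section Inst

open Limits

theorem homLift_iff {X Y : RAlg.{u}} (f : algFib.obj X ⟶ algFib.obj Y) (φ : X ⟶ Y) :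
    algFib.IsHomLift f φ ↔ φ.f.right = f :=
  ⟨fun _ => (IsHomLift.eq_of_isHomLift algFib f φ).symm, fun h => h ▸ IsHomLift.map algFib φ⟩

/-- `(𝟭 B, R (𝟭 B))` as an object of the fibre over `B`. -/
def unitFiber (B : Cat.{u, u}) : algFib.Fiber B := ⟨unitAlg B, rfl⟩

theorem unitFiber_existsUnique (B : Cat.{u, u}) (Y : algFib.Fiber B) :
    ∃! m : Y ⟶ unitFiber B, True := by
  obtain ⟨Y, rfl⟩ := Y
  refine ⟨⟨mkHom (Y := unitAlg Y.A.right) Y.fn (𝟭 _) rfl Y.str_comp.symm, (homLift_iff _ _).2 rfl⟩,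
    trivial, ?_⟩
  intro m _
  have h : m.1.f.right = 𝟙 _ := (homLift_iff _ _).1 m.2
  have h' := sq m.1.f
  refine Subtype.ext (RAlg.hom_ext ?_ (congrArg Cat.Hom.toFunctor h))
  rw [h] at h'
  exact h'

/-- `(𝟭 B, R (𝟭 B))` is terminal in the fibre over `B`. -/
noncomputable def unitFiberIsTerminal (B : Cat.{u, u}) : IsTerminal (unitFiber B) :=
  IsTerminal.ofUniqueHom (fun Y => (unitFiber_existsUnique B Y).choose)
    (fun Y m => (unitFiber_existsUnique B Y).choose_spec.2 m trivial)

/-- The loop `(⟨1, 1⟩, refl) : (𝟭 B, R (𝟭 B)) ⟶ (⟨cod, dom⟩, s_B)` on `B`. -/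
noncomputable def pathLoop (B : Cat.{u, u}) : Loop algFib B where
  top := unitFiber B
  isTerminal := unitFiberIsTerminal B
  obj := ⟨pathAlg B, rfl⟩
  hom := reflHom B
  isHomLift := (homLift_iff _ _).2 rfl

/-- The cartesian arrow from `reindexAlg X` to `X` over the first projection. -/
def reindexProj (X : RAlg.{u}) : reindexAlg X ⟶ X :=
  mkHom (X := reindexAlg X) (CategoryTheory.Prod.fst _ _) (CategoryTheory.Prod.fst _ _) rfl rfl

/-- The first projection of the product `domainAlg X`. -/
def domainProj₁ (X : RAlg.{u}) : domainAlg X ⟶ reindexAlg X :=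
  mkHom (X := domainAlg X) (Y := reindexAlg X) ((M.toPt X.fn).prod' (M.toBase X.fn)) (𝟭 _) rfl
    (prod_functor_ext (congrArg (fun T => T ⋙ X.str)
      (M.map_comp (F := domainFn X) (F' := reindexFn X) (F'' := X.fn)
        ((M.toPt X.fn).prod' (M.toBase X.fn)) (𝟭 _) rfl (CategoryTheory.Prod.fst _ _)
        (CategoryTheory.Prod.fst _ _) rfl rfl).symm) rfl)

/-- The second projection of the product `domainAlg X`. -/
def domainProj₂ (X : RAlg.{u}) : domainAlg X ⟶ pathAlg X.A.right :=
  mkHom (X := domainAlg X) (Y := pathAlg _) (M.toIso X.fn) (𝟭 _) rfl (domainStr_toIso X).symm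

theorem reindexProj_cartesian (X : RAlg.{u}) :
    algFib.IsStronglyCartesian (fst (algFib.obj X) (algFib.obj X)) (reindexProj X) where
  toIsHomLift := (homLift_iff (X := reindexAlg X) (Y := X) _ _).2 rfl
  universal_property' := by
    intro C g φ h
    have h : φ.f.right = g ≫ fst X.A.right X.A.right := (homLift_iff _ _).1 h
    have h1 : φ.f.left.toFunctor ⋙ X.fn =
        C.fn ⋙ g.toFunctor ⋙ CategoryTheory.Prod.fst X.A.right X.A.right :=
      (sq φ.f).trans (congrArg (fun T => C.fn ⋙ Cat.Hom.toFunctor T) h)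
    let H : C.A.left ⥤ X.A.left × X.A.right :=
      φ.f.left.toFunctor.prod' (C.fn ⋙ g.toFunctor ⋙ CategoryTheory.Prod.snd _ _)
    have hH : H ⋙ reindexFn X = C.fn ⋙ g.toFunctor := prod_functor_ext h1 rfl
    refine ⟨mkHom (X := C) (Y := reindexAlg X) H g.toFunctor hH (prod_functor_ext ?_ ?_),
      ⟨(homLift_iff _ _).2 rfl, RAlg.hom_ext rfl (congrArg Cat.Hom.toFunctor h).symm⟩, ?_⟩
    · have e := RAlg.hom_str φ
      have e' := M.map_comp (F := C.fn) (F' := reindexFn X) (F'' := X.fn) H g.toFunctor hH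
        (CategoryTheory.Prod.fst _ _) (CategoryTheory.Prod.fst _ _) rfl h1
      refine (congrArg (fun T => T ⋙ X.str) e').symm.trans (Eq.trans ?_ e)
      exact congrArg (fun T => T ⋙ X.str)
        (M.map_congr (F := C.fn) (F' := X.fn) h1 rfl (congrArg Cat.Hom.toFunctor h.symm))
    · exact congrArg (fun T => T ⋙ g.toFunctor ⋙ CategoryTheory.Prod.snd _ _) C.str_comp.symm
    · rintro ψ ⟨hψ, hψ'⟩
      have hψ : ψ.f.right = g := (homLift_iff _ _).1 hψ
      have h2 : ψ.f.left.toFunctor ⋙ reindexFn X = C.fn ⋙ g.toFunctor :=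
        (sq ψ.f).trans (congrArg (fun T => C.fn ⋙ Cat.Hom.toFunctor T) hψ)
      exact RAlg.hom_ext (prod_functor_ext (congrArg (fun T => T.f.left.toFunctor) hψ')
        (congrArg (fun T : (C.A.left ⥤ X.A.right × X.A.right) =>
          T ⋙ CategoryTheory.Prod.snd _ _) h2)) (congrArg Cat.Hom.toFunctor hψ)

theorem domain_existsUnique (X C : RAlg.{u}) (f : algFib.obj C ⟶ algFib.obj X ⊗ algFib.obj X)
    (φ₁ : C ⟶ reindexAlg X) (φ₂ : C ⟶ pathAlg X.A.right) (h₁ : algFib.IsHomLift f φ₁)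
    (h₂ : algFib.IsHomLift f φ₂) :
    ∃! ψ : C ⟶ domainAlg X, algFib.IsHomLift f ψ ∧ ψ ≫ domainProj₁ X = φ₁ ∧
      ψ ≫ domainProj₂ X = φ₂ := by
  have h₁ : φ₁.f.right = f := (homLift_iff (Y := reindexAlg X) _ _).1 h₁
  have h₂ : φ₂.f.right = f := (homLift_iff (Y := pathAlg X.A.right) _ _).1 h₂
  let K : C.A.right ⥤ X.A.right × X.A.right := f.toFunctor
  have e₁ : φ₁.f.left.toFunctor ⋙ reindexFn X = C.fn ⋙ K :=
    (sq φ₁.f).trans (congrArg (fun T => C.fn ⋙ Cat.Hom.toFunctor T) h₁)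
  have e₂ : φ₂.f.left.toFunctor ⋙ endpoints X.A.right = C.fn ⋙ K :=
    (sq φ₂.f).trans (congrArg (fun T => C.fn ⋙ Cat.Hom.toFunctor T) h₂)
  have e : (φ₁.f.left.toFunctor ⋙ CategoryTheory.Prod.fst X.A.left X.A.right) ⋙ X.fn =
      φ₂.f.left.toFunctor ⋙ M.toPt (𝟭 X.A.right) :=
    congrArg (fun T => T ⋙ CategoryTheory.Prod.fst _ _) (e₁.trans e₂.symm)
  let H : C.A.left ⥤ M X.fn := M.pullLift _ _ e
  have hI : H ⋙ M.toIso X.fn = φ₂.f.left.toFunctor := M.pullLift_toIso _ _ e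
  have hP : H ⋙ (M.toPt X.fn).prod' (M.toBase X.fn) = φ₁.f.left.toFunctor :=
    prod_functor_ext rfl (congrArg (fun T : (C.A.left ⥤ X.A.right × X.A.right) =>
      T ⋙ CategoryTheory.Prod.snd _ _) (e₂.trans e₁.symm))
  have hH : H ⋙ domainFn X = C.fn ⋙ K :=
    (congrArg (fun T => T ⋙ endpoints X.A.right) hI).trans e₂
  have key₁ : M.map H K hH ⋙
      M.map (F := domainFn X) (M.toPt X.fn) (CategoryTheory.Prod.fst _ _) rfl ⋙ X.str =
      C.str ⋙ H ⋙ M.toPt X.fn := by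
    have a := RAlg.hom_str (φ₁ ≫ reindexProj X)
    have a₁ := M.map_comp (F := C.fn) (F' := domainFn X) (F'' := X.fn) H K hH
        (M.toPt X.fn) (CategoryTheory.Prod.fst _ _) rfl
        (congrArg (fun T => T ⋙ CategoryTheory.Prod.fst _ _) hH)
    refine (congrArg (fun T => T ⋙ X.str) a₁).symm.trans (Eq.trans ?_ a)
    exact congrArg (fun T => T ⋙ X.str)
      (M.map_congr (F := C.fn) (F' := X.fn) _ rfl
        (congrArg (fun T => Cat.Hom.toFunctor T ⋙ CategoryTheory.Prod.fst _ _) h₁.symm))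
  have key₂ : M.map H K hH ⋙
      M.map (F := domainFn X) (F' := endpoints X.A.right) (M.toIso X.fn) (𝟭 _) rfl ⋙
      pathStr X.A.right = C.str ⋙ H ⋙ M.toIso X.fn := by
    have a := RAlg.hom_str φ₂
    have a₁ := M.map_comp (F := C.fn) (F' := domainFn X) (F'' := endpoints X.A.right) H
      K hH (M.toIso X.fn) (𝟭 _) rfl hH
    refine (congrArg (fun T => T ⋙ pathStr X.A.right) a₁).symm.trans (Eq.trans ?_
      (a.trans (congrArg (fun T => C.str ⋙ T) hI.symm)))
    exact congrArg (fun T => T ⋙ pathStr X.A.right)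
      (M.map_congr (F := C.fn) (F' := endpoints X.A.right) _ hI
        (congrArg (fun T => Cat.Hom.toFunctor T) h₂.symm))
  refine ⟨mkHom (X := C) (Y := domainAlg X) H K hH (M.pull_ext key₁ ?_),
    ⟨(homLift_iff (Y := domainAlg X) _ _).2 rfl,
      RAlg.hom_ext hP (congrArg Cat.Hom.toFunctor h₁.symm),
      RAlg.hom_ext hI (congrArg Cat.Hom.toFunctor h₂.symm)⟩, ?_⟩
  · exact (congrArg (fun T => M.map H K hH ⋙ T) (domainStr_toIso X)).trans key₂
  · rintro ψ ⟨a, b, c⟩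
    have a : ψ.f.right = f := (homLift_iff (Y := domainAlg X) _ _).1 a
    refine RAlg.hom_ext (M.pull_ext ?_ ?_) (congrArg Cat.Hom.toFunctor a)
    · exact congrArg (fun T => T.f.left.toFunctor ⋙ CategoryTheory.Prod.fst _ _) b
    · exact (congrArg (fun T => T.f.left.toFunctor) c).trans hI.symm

/-- The product `pr₁^* (F, S) ∧ (⟨cod, dom⟩, s_B)`, realised by the algebra `(D, S_D)` on
`D : M F ⥤ B × B`. -/
noncomputable def domain (X : RAlg.{u}) :
    TransportDomain (pathLoop (algFib.obj X)) (Functor.Fiber.mk (a := X) rfl) where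
  reindex := ⟨reindexAlg X, rfl⟩
  proj := reindexProj X
  cartesian := reindexProj_cartesian X
  obj := ⟨domainAlg X, rfl⟩
  π₁ := ⟨domainProj₁ X, (homLift_iff (X := domainAlg X) (Y := reindexAlg X) _ _).2 rfl⟩
  π₂ := ⟨domainProj₂ X, (homLift_iff (X := domainAlg X) (Y := pathAlg _) _ _).2 rfl⟩
  existsUnique_lift := domain_existsUnique X _

end Inst

end CatAWFS

/-!
Let `T : M F ⥤ A` be a functor over `B`, and let `(D, S_D)` be the algebra realising the product.
The functor `M F ⥤ M D`, `(A, x) ↦ ((A, 𝟙), (𝟙, x))`, is a section of `S_D`, and also of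
`M (T, pr₂) : M D ⥤ M F` once `T (A, 𝟙) = A`; so `M (T, pr₂) ⋙ S = S_D ⋙ T` restricts along it to
`S = T`. For `T = S`, both sides of that equation send `((A, x), (b₁, b₂))` to `S (A, b₂ ≫ x)` by
the associativity law, because `b₁⁻¹` cancels `b₁`. Any other product is isomorphic to `(D, S_D)`
by an isomorphism that preserves strict carriers.
-/

namespace CatAWFS

section General

variable {E : Type u₁} [Category.{v₁} E] {B : Type u₂} [Category.{v₂} B]
  [CartesianMonoidalCategory B] {p : E ⥤ B} {X : B} {ℓ : Loop p X} {A : p.Fiber X}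

namespace TransportDomain

theorem existsUnique_pair (D : TransportDomain ℓ A) {Y : B} {C : E} (f : Y ⟶ X ⊗ X)
    (α : C ⟶ A.1) (β : C ⟶ ℓ.obj.1) (hα : p.IsHomLift (f ≫ fst X X) α) (hβ : p.IsHomLift f β) :
    ∃! ψ : C ⟶ D.obj.1, p.IsHomLift f ψ ∧ ψ ≫ D.π₁.1 ≫ D.proj = α ∧ ψ ≫ D.π₂.1 = β := by
  obtain rfl : p.obj C = Y := IsHomLift.domain_eq p f β
  have := D.cartesian
  have := D.π₁.2
  obtain ⟨k, ⟨hk, hkα⟩, k_unique⟩ := Functor.IsStronglyCartesian.universal_property p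
    (fst X X) D.proj f _ rfl α
  obtain ⟨ψ, ⟨hψ, hψk, hψβ⟩, ψ_unique⟩ := D.existsUnique_lift f k β hk hβ
  refine ⟨ψ, ⟨hψ, by rw [← Category.assoc, hψk, hkα], hψβ⟩, ?_⟩
  rintro ψ' ⟨hψ', hψ'α, hψ'β⟩
  exact ψ_unique ψ' ⟨hψ', k_unique _ ⟨inferInstance, by rw [Category.assoc, hψ'α]⟩, hψ'β⟩

theorem isHomLift_π₁_proj (D : TransportDomain ℓ A) : p.IsHomLift (fst X X) (D.π₁.1 ≫ D.proj) := by
  have := D.cartesian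
  have := D.π₁.2
  infer_instance

theorem hom_ext (D : TransportDomain ℓ A) {Y : B} {C : E} (f : Y ⟶ X ⊗ X) {ψ ψ' : C ⟶ D.obj.1}
    [p.IsHomLift f ψ] [p.IsHomLift f ψ']
    (h₁ : ψ ≫ D.π₁.1 ≫ D.proj = ψ' ≫ D.π₁.1 ≫ D.proj) (h₂ : ψ ≫ D.π₂.1 = ψ' ≫ D.π₂.1) :
    ψ = ψ' := by
  have := D.isHomLift_π₁_proj
  have := D.π₂.2
  exact (D.existsUnique_pair f (ψ' ≫ D.π₁.1 ≫ D.proj) (ψ' ≫ D.π₂.1) inferInstance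
    inferInstance).unique ⟨inferInstance, h₁, h₂⟩ ⟨inferInstance, rfl, rfl⟩

variable (D D' : TransportDomain ℓ A)

theorem exists_comparison :
    ∃ e : D.obj.1 ⟶ D'.obj.1, p.IsHomLift (𝟙 (X ⊗ X)) e ∧
      e ≫ D'.π₁.1 ≫ D'.proj = D.π₁.1 ≫ D.proj ∧ e ≫ D'.π₂.1 = D.π₂.1 := by
  have := D.isHomLift_π₁_proj
  exact (D'.existsUnique_pair (𝟙 (X ⊗ X)) (D.π₁.1 ≫ D.proj) D.π₂.1 inferInstance D.π₂.2).exists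

/-- The vertical comparison arrow between two realisations of the product `pr₁^* A ∧ I`. -/
noncomputable def comparison : D.obj.1 ⟶ D'.obj.1 :=
  (exists_comparison D D').choose

instance isHomLift_comparison : p.IsHomLift (𝟙 (X ⊗ X)) (comparison D D') :=
  (exists_comparison D D').choose_spec.1

theorem comparison_π₁_proj : comparison D D' ≫ D'.π₁.1 ≫ D'.proj = D.π₁.1 ≫ D.proj :=
  (exists_comparison D D').choose_spec.2.1

theorem comparison_π₂ : comparison D D' ≫ D'.π₂.1 = D.π₂.1 :=
  (exists_comparison D D').choose_spec.2.2

theorem comparison_comp_comparison : comparison D D' ≫ comparison D' D = 𝟙 _ := by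
  have := IsHomLift.id (p := p) D.obj.2
  exact D.hom_ext (𝟙 (X ⊗ X)) (by simp only [Category.assoc, comparison_π₁_proj, Category.id_comp])
    (by simp only [Category.assoc, comparison_π₂, Category.id_comp])

theorem refl_spec : p.IsHomLift (lift (𝟙 X) (𝟙 X)) D.refl ∧ D.refl ≫ D.π₁.1 ≫ D.proj = 𝟙 A.1 ∧
    D.refl ≫ D.π₂.1 = (ℓ.isTerminal.from A).1 ≫ ℓ.hom :=
  D.existsUnique_refl.choose_spec.1

theorem refl_comp_comparison : D.refl ≫ comparison D D' = D'.refl := by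
  obtain ⟨_, hπ₁, hπ₂⟩ := D.refl_spec
  refine D'.existsUnique_refl.choose_spec.2 _ ⟨inferInstance, ?_, ?_⟩
  · rw [Category.assoc, comparison_π₁_proj, hπ₁]
  · rw [Category.assoc, comparison_π₂, hπ₂]

end TransportDomain

namespace Carrier

theorem ext {D : TransportDomain ℓ A} {s t : Carrier D} (h : s.hom = t.hom) : s = t := by
  cases s; cases h; rfl

/-- Carriers for two realisations of the product `pr₁^* A ∧ I` correspond by precomposition with
the comparison arrows. -/
noncomputable def equiv (D D' : TransportDomain ℓ A) : Carrier D ≃ Carrier D' where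
  toFun t := ⟨D'.comparison D ≫ t.hom, have := t.isHomLift; inferInstance⟩
  invFun t := ⟨D.comparison D' ≫ t.hom, have := t.isHomLift; inferInstance⟩
  left_inv t := ext <| by
    change D.comparison D' ≫ D'.comparison D ≫ t.hom = t.hom
    rw [← Category.assoc, TransportDomain.comparison_comp_comparison, Category.id_comp]
  right_inv t := ext <| by
    change D'.comparison D ≫ D.comparison D' ≫ t.hom = t.hom
    rw [← Category.assoc, TransportDomain.comparison_comp_comparison, Category.id_comp]

theorem isStrict_equiv_iff {D D' : TransportDomain ℓ A} (t : Carrier D) :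
    (equiv D D' t).IsStrict ↔ t.IsStrict := by
  change D'.refl ≫ D'.comparison D ≫ t.hom = 𝟙 A.1 ↔ D.refl ≫ t.hom = 𝟙 A.1
  rw [← Category.assoc, TransportDomain.refl_comp_comparison]

theorem existsUnique_isStrict_congr (D D' : TransportDomain ℓ A) :
    (∃! t : Carrier D, t.IsStrict) ↔ ∃! t : Carrier D', t.IsStrict :=
  (equiv D D').existsUnique_congr fun t => (isStrict_equiv_iff t).symm

end Carrier

end General

section Pullback

variable {A B C : Type u} [Category.{u} A] [Category.{u} B] [Category.{u} C] {F : A ⥤ B}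

theorem M.pullLift_iso_heq (P : C ⥤ A) (Q : C ⥤ M (𝟭 B)) (h : P ⋙ F = Q ⋙ M.toPt (𝟭 B)) (c : C) :
    HEq ((M.pullLift P Q h).obj c).iso.hom (Q.obj c).iso.hom :=
  comp_eqToHom_heq _ (Functor.congr_obj h c).symm

theorem M.pullLift_comp_map {A' : Type u} [Category.{u} A'] {F' : A' ⥤ B} (P : C ⥤ A)
    (Q : C ⥤ M (𝟭 B)) (h : P ⋙ F = Q ⋙ M.toPt (𝟭 B)) (H : A ⥤ A') (hH : H ⋙ F' = F)
    (h' : (P ⋙ H) ⋙ F' = Q ⋙ M.toPt (𝟭 B)) :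
    M.pullLift P Q h ⋙ M.map (F := F) H (𝟭 B) hH = M.pullLift (P ⋙ H) Q h' :=
  M.functor_ext rfl rfl fun c => (M.map_iso_heq H (𝟭 B) hH _).trans <|
    (M.pullLift_iso_heq P Q h c).trans (M.pullLift_iso_heq (P ⋙ H) Q h' c).symm

end Pullback

section Algebra

theorem right_toFunctor_eq_of_isHomLift {X Y : RAlg.{u}} {f : algFib.obj X ⟶ algFib.obj Y}
    {φ : X ⟶ Y} (h : algFib.IsHomLift f φ) : φ.f.right.toFunctor = f.toFunctor :=
  congrArg Cat.Hom.toFunctor ((homLift_iff f φ).1 h)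

theorem RAlg.left_comp_fn {X Y : RAlg.{u}} (φ : X ⟶ Y) {K : X.A.right ⥤ Y.A.right}
    (hK : φ.f.right.toFunctor = K) : φ.f.left.toFunctor ⋙ Y.fn = X.fn ⋙ K :=
  hK ▸ sq φ.f

theorem RAlg.map_left_comp_str {X Y : RAlg.{u}} (φ : X ⟶ Y) {K : X.A.right ⥤ Y.A.right}
    (hK : φ.f.right.toFunctor = K) :
    M.map φ.f.left.toFunctor K (RAlg.left_comp_fn φ hK) ⋙ Y.str =
      X.str ⋙ φ.f.left.toFunctor := by
  subst hK
  exact RAlg.hom_str φ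

variable (X : RAlg.{u})

/-- The functor `M F ⥤ M D`, `(A, x : B ≅ F A) ↦ ((A, 𝟙), (𝟙, x) : (F A, B) ≅ (F A, F A))`, which
is a section of `S_D : M D ⥤ M F`. -/
def domainSection : M X.fn ⥤ M (domainFn X) where
  obj m := ⟨(M.unit X.fn).obj m.pt, (X.fn.obj m.pt, m.base), Iso.prod (Iso.refl _) m.iso⟩
  map f :=
    { base := (X.fn.map f.pt, f.base)
      pt := (M.unit X.fn).map f.pt
      w := Prod.ext ((Category.comp_id _).trans (Category.id_comp _).symm) f.w }

theorem domainSection_comp_domainStr : domainSection X ⋙ domainStr X = 𝟭 _ := by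
  refine M.pull_ext ?_ ?_
  · have factors_unit : domainSection X ⋙
        M.map (F := domainFn X) (M.toPt X.fn) (CategoryTheory.Prod.fst _ _) rfl =
        M.toPt X.fn ⋙ M.unit X.fn :=
      M.functor_ext rfl rfl fun _ => heq_of_eq (Category.comp_id _)
    exact (congrArg (· ⋙ X.str) factors_unit).trans (congrArg (M.toPt X.fn ⋙ ·) X.unit_str)
  · refine (congrArg (domainSection X ⋙ ·) (domainStr_toIso X)).trans ?_
    refine M.functor_ext rfl rfl fun c => heq_of_eq ?_
    change (c.iso.hom ≫ 𝟙 _) ≫ 𝟙 _ ≫ 𝟙 _ ≫ 𝟙 _ = c.iso.hom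
    simp only [Category.comp_id]

theorem domainSection_comp_map (T : M X.fn ⥤ X.A.left) (hT : T ⋙ X.fn = M.toBase X.fn)
    (hu : M.unit X.fn ⋙ T = 𝟭 _) :
    domainSection X ⋙ M.map (F := domainFn X) T (CategoryTheory.Prod.snd _ _) hT = 𝟭 _ :=
  M.functor_ext (congrArg (M.toPt X.fn ⋙ ·) hu) rfl fun _ =>
    M.map_iso_heq (F := domainFn X) _ _ hT _

theorem eq_str_of_unit_comp_eq_id (T : M X.fn ⥤ X.A.left) (hT : T ⋙ X.fn = M.toBase X.fn)
    (hS : M.map (F := domainFn X) T (CategoryTheory.Prod.snd _ _) hT ⋙ X.str = domainStr X ⋙ T)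
    (hu : M.unit X.fn ⋙ T = 𝟭 _) : T = X.str :=
  calc
    T = (domainSection X ⋙ domainStr X) ⋙ T := by rw [domainSection_comp_domainStr]; rfl
    _ = (domainSection X ⋙ M.map (F := domainFn X) T (CategoryTheory.Prod.snd _ _) hT) ⋙ X.str := by
      rw [Functor.assoc, Functor.assoc, hS]
    _ = X.str := by rw [domainSection_comp_map X T hT hu]; rfl

/-- The functor `M D ⥤ M (R F)` sending `((A, x : B ≅ F A), (b₁, b₂) : (B₁, B₂) ≅ (F A, B))` to
`((A, b₁), b₂ ≫ x ≫ b₁⁻¹)`; it becomes `S_D` when `S` is applied to `(A, b₁)`. -/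
def domainSplit : M (domainFn X) ⥤ M (M.toBase X.fn) :=
  M.pullLift (M.map (F := domainFn X) (M.toPt X.fn) (CategoryTheory.Prod.fst _ _) rfl)
    (M.map (F := domainFn X) (F' := endpoints X.A.right) (M.toIso X.fn) (𝟭 _) rfl ⋙
      pathStr X.A.right) rfl

theorem domainSplit_comp_map :
    domainSplit X ⋙ M.map (F := M.toBase X.fn) X.str (𝟭 _) X.str_comp = domainStr X :=
  M.pullLift_comp_map (F := M.toBase X.fn) _ _ rfl X.str X.str_comp (domainStr_aux X)

theorem domainSplit_comp_mult : domainSplit X ⋙ M.mult X.fn =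
    M.map (F := domainFn X) (F' := M.toBase X.fn) (𝟭 _) (CategoryTheory.Prod.snd _ _) rfl ⋙
      M.mult X.fn := by
  refine M.functor_ext rfl rfl fun c => heq_of_eq ?_
  let b₁ : c.base.1 ≅ X.fn.obj c.pt.pt := (CategoryTheory.Prod.fst _ _).mapIso c.iso
  let b₂ : c.base.2 ≅ c.pt.base := (CategoryTheory.Prod.snd _ _).mapIso c.iso
  let x := c.pt.iso
  -- The identities are the `eqToHom`s by which `M.map` and `M.pullLift` adjust endpoints.
  change (((b₂.hom ≫ 𝟙 _) ≫ x.hom ≫ 𝟙 _ ≫ b₁.inv) ≫ 𝟙 _) ≫ b₁.hom ≫ 𝟙 _ = (b₂.hom ≫ 𝟙 _) ≫ x.hom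
  simp

theorem map_str_comp_str :
    M.map (F := domainFn X) X.str (CategoryTheory.Prod.snd _ _) X.str_comp ⋙ X.str =
      domainStr X ⋙ X.str := by
  let mapSnd : M (domainFn X) ⥤ M (M.toBase X.fn) := M.map (𝟭 _) (CategoryTheory.Prod.snd _ _) rfl
  let mapStr : M (M.toBase X.fn) ⥤ M X.fn := M.map X.str (𝟭 _) X.str_comp
  calc
    M.map (F := domainFn X) X.str (CategoryTheory.Prod.snd _ _) X.str_comp ⋙ X.str
      = (mapSnd ⋙ mapStr) ⋙ X.str := congrArg (· ⋙ X.str) <|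
        M.map_comp (F := domainFn X) (F' := M.toBase X.fn) (𝟭 _) (CategoryTheory.Prod.snd _ _) rfl
          X.str (𝟭 _) X.str_comp X.str_comp
    _ = (mapSnd ⋙ M.mult X.fn) ⋙ X.str := congrArg (mapSnd ⋙ ·) X.mult_str.symm
    _ = (domainSplit X ⋙ M.mult X.fn) ⋙ X.str := by rw [domainSplit_comp_mult]
    _ = (domainSplit X ⋙ mapStr) ⋙ X.str := congrArg (domainSplit X ⋙ ·) X.mult_str
    _ = domainStr X ⋙ X.str := by rw [domainSplit_comp_map]

/-- The carrier `(pr₂, S) : (D, S_D) ⟶ (F, S)`. -/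
noncomputable def strCarrier : Carrier (domain X) where
  hom := mkHom (X := domainAlg X) X.str (CategoryTheory.Prod.snd _ _) X.str_comp
    (map_str_comp_str X)
  isHomLift := (homLift_iff (X := domainAlg X) _ _).2 rfl

theorem left_eq_fn_of_vertical (m : Functor.Fiber.mk (p := algFib) (a := X) rfl ⟶
    unitFiber (algFib.obj X)) : m.1.f.left.toFunctor = X.fn :=
  RAlg.left_comp_fn (Y := unitAlg X.A.right) m.1
    (right_toFunctor_eq_of_isHomLift (X := X) (Y := unitAlg X.A.right) m.2)

theorem domain_refl_left : (domain X).refl.f.left.toFunctor = M.unit X.fn := by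
  obtain ⟨-, hπ₁, hπ₂⟩ := (domain X).refl_spec
  refine M.pull_ext (congrArg (fun φ => φ.f.left.toFunctor) hπ₁) ?_
  exact (congrArg (fun φ => φ.f.left.toFunctor) hπ₂).trans
    (congrArg (· ⋙ M.unit (𝟭 _)) (left_eq_fn_of_vertical X _))

theorem domain_refl_right :
    (domain X).refl.f.right.toFunctor = (𝟭 X.A.right).prod' (𝟭 X.A.right) :=
  right_toFunctor_eq_of_isHomLift (Y := domainAlg X) (domain X).refl_spec.1

variable {X}

theorem carrier_right_eq_snd (t : Carrier (domain X)) :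
    t.hom.f.right.toFunctor = CategoryTheory.Prod.snd X.A.right X.A.right :=
  right_toFunctor_eq_of_isHomLift (X := domainAlg X) (Y := X) t.isHomLift

theorem carrier_isStrict_iff (t : Carrier (domain X)) :
    t.IsStrict ↔ M.unit X.fn ⋙ t.hom.f.left.toFunctor = 𝟭 _ := by
  rw [← domain_refl_left]
  refine ⟨fun ht => congrArg (fun φ : X ⟶ X => φ.f.left.toFunctor) ht,
    fun hu => RAlg.hom_ext hu ?_⟩
  change (domain X).refl.f.right.toFunctor ⋙ t.hom.f.right.toFunctor = 𝟭 _
  rw [domain_refl_right, carrier_right_eq_snd]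
  rfl

theorem carrier_isStrict_iff_left_eq_str (t : Carrier (domain X)) :
    t.IsStrict ↔ t.hom.f.left.toFunctor = X.str := by
  refine (carrier_isStrict_iff t).trans ⟨fun hu => ?_, fun h => h ▸ X.unit_str⟩
  have hr := carrier_right_eq_snd t
  exact eq_str_of_unit_comp_eq_id X _ (RAlg.left_comp_fn (X := domainAlg X) t.hom hr)
    (RAlg.map_left_comp_str (X := domainAlg X) t.hom hr) hu

theorem strCarrier_isStrict : (strCarrier X).IsStrict :=
  (carrier_isStrict_iff_left_eq_str _).2 rfl

theorem eq_strCarrier_of_isStrict (t : Carrier (domain X)) (ht : t.IsStrict) : t = strCarrier X :=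
  Carrier.ext <| RAlg.hom_ext (X := domainAlg X) ((carrier_isStrict_iff_left_eq_str t).1 ht)
    (carrier_right_eq_snd t)

end Algebra

end CatAWFS

/-- Let `X` be an algebra `(F : A ⥤ B, S : M F ⥤ A)`. There is exactly one strict carrier at `X` for
the loop `(⟨1, 1⟩, refl)` on `B`, whichever product `pr₁^* (F, S) ∧ (⟨cod, dom⟩, s_B)` is taken; and
when the product is taken to be `(D : M F ⥤ B × B, S_D)` it is the arrow `S` over the second
projection. -/
theorem lemma5p6 (X : CatAWFS.RAlg.{u}) :
    (∀ D : CatAWFS.TransportDomain (CatAWFS.pathLoop (CatAWFS.algFib.obj X))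
        (Functor.Fiber.mk (a := X) rfl), ∃! t : CatAWFS.Carrier D, t.IsStrict) ∧
    ∃ t : CatAWFS.Carrier (CatAWFS.domain X), t.IsStrict ∧ t.hom.f.left.toFunctor = X.str :=
  ⟨fun D => (CatAWFS.Carrier.existsUnique_isStrict_congr (CatAWFS.domain X) D).1
    ⟨CatAWFS.strCarrier X, CatAWFS.strCarrier_isStrict, CatAWFS.eq_strCarrier_of_isStrict⟩,
   CatAWFS.strCarrier X, CatAWFS.strCarrier_isStrict, rfl⟩
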